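/- For integers $n \ge 1$ and $d \ge 0$, let $\Delta^n$ be the simplicial complex consisting of all subsets of an $n$-element set (the empty set included), and let $\mathrm{Hasse}_d(\Delta^n)$ be level $d$ of its Hasse diagram: the graph whose vertices are the $(d-1)$-simplices and the $d$-simplices of $\Delta^n$ (the subsets with $d$ and with $d+1$ elements, respectively), in which each $d$-simplex is adjacent to exactly its $(d-1)$-faces. Write $\mathrm{tw}(G)$ for the treewidth of a finite graph $G$, i.e. the minimum over all tree decompositions $(T,(X_t)_{t\in T})$ of $G$ of the width $\max_{t}|X_t|-1$. **Theorem.** For $n \ge 2d+1$, the treewidth of $\mathrm{Hasse}_d(\Delta^n)$ is $\Omega\!\left(\binom{n}{d}\cdot\frac{1}{d+1}\right)$. That is, there is an absolute constant $c>0$ such that for all integers $d\ge 0$ and $n\ge 2d+1$, $$\mathrm{tw}\bigl(\mathrm{Hasse}_d(\Delta^n)\bigr)\;\ge\; c\cdot\binom{n}{d}\cdot\frac{1}{d+1}.$$ -/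

import Mathlib

namespace HasseTreewidth

/-- An abstract simplicial complex on (a subset of) `V`: a set of finite sets closed under taking
subsets. The empty set counts as a simplex, of dimension `-1`. -/
structure SimplicialComplex (V : Type*) where
  simplices : Set (Finset V)
  down_closed : ∀ σ ∈ simplices, ∀ τ ⊆ σ, τ ∈ simplices

/-- `Δ^n`: the complex of all subsets of a set of `n` vertices. -/
def fullSimplex (n : ℕ) : SimplicialComplex (Fin n) where
  simplices := Set.univ
  down_closed := fun _ _ _ _ => Set.mem_univ _

/-- The set of simplices of `K` with exactly `k` vertices, that is, of dimension `k - 1`. -/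
def SimplicialComplex.withCard {V : Type*} (K : SimplicialComplex V) (k : ℕ) : Set (Finset V) :=
  {σ | σ ∈ K.simplices ∧ σ.card = k}

/-- Level `d` of the Hasse diagram of `K`: the vertices are the `(d-1)`-simplices (`d` elements)
and the `d`-simplices (`d + 1` elements) of `K`; a `d`-simplex is joined to each of its
`(d-1)`-faces. -/
def hasse {V : Type*} (K : SimplicialComplex V) (d : ℕ) :
    SimpleGraph ↥(K.withCard d ∪ K.withCard (d + 1)) where
  Adj σ τ :=
    (σ.1.card = d ∧ τ.1.card = d + 1 ∧ σ.1 ⊆ τ.1) ∨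
    (τ.1.card = d ∧ σ.1.card = d + 1 ∧ τ.1 ⊆ σ.1)
  symm := ⟨fun _ _ h => h.symm⟩
  loopless := ⟨fun σ h => by omega⟩

/-- A tree decomposition of `G` whose tree has node set `I`. -/
structure TreeDecomposition {V : Type*} (G : SimpleGraph V) (I : Type*) where
  tree : SimpleGraph I
  isTree : tree.IsTree
  bag : I → Finset V
  exists_mem_bag : ∀ v : V, ∃ t, v ∈ bag t
  exists_edge_bag : ∀ u v : V, G.Adj u v → ∃ t, u ∈ bag t ∧ v ∈ bag t
  connected : ∀ v : V, (tree.induce {t | v ∈ bag t}).Connected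

/-- The width, `max_t |X_t| - 1`. (The subtraction truncates only if all bags are empty, which
forces the graph to have no vertices.) -/
def TreeDecomposition.width {V : Type*} {G : SimpleGraph V} {I : Type*} [Fintype I]
    (D : TreeDecomposition G I) : ℕ :=
  (Finset.univ.sup fun t => (D.bag t).card) - 1

/-- The treewidth of a finite graph: the minimum width of a tree decomposition over a finite
tree. -/
noncomputable def treewidth {V : Type*} [Finite V] (G : SimpleGraph V) : ℕ :=
  sInf {k | ∃ (I : Type) (_ : Fintype I) (D : TreeDecomposition G I), D.width = k}

end HasseTreewidth

namespace HasseTreewidth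

open Finset

/-- `u` and `v` lie in the same connected component of `G - S`. -/
def ConnAvoiding {V : Type*} (G : SimpleGraph V) (S : Set V) (u v : V) : Prop :=
  ∃ (hu : u ∈ Sᶜ) (hv : v ∈ Sᶜ), (G.induce Sᶜ).Reachable ⟨u, hu⟩ ⟨v, hv⟩

namespace ConnAvoiding

variable {V : Type*} {G : SimpleGraph V} {S : Set V} {u v w : V}

lemma refl (hu : u ∉ S) : ConnAvoiding G S u u := ⟨hu, hu, .refl _⟩

lemma trans (h : ConnAvoiding G S u v) (h' : ConnAvoiding G S v w) : ConnAvoiding G S u w :=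
  let ⟨hu, _, h⟩ := h
  let ⟨_, hw, h'⟩ := h'
  ⟨hu, hw, h.trans h'⟩

lemma of_adj (hu : u ∉ S) (hv : v ∉ S) (h : G.Adj u v) : ConnAvoiding G S u v :=
  ⟨hu, hv, SimpleGraph.Adj.reachable (by simpa using h)⟩

end ConnAvoiding

namespace TreeDecomposition

variable {V I : Type*} {G : SimpleGraph V} (D : TreeDecomposition G I)

lemma card_bag_le_width_add_one [Fintype I] (t : I) : #(D.bag t) ≤ D.width + 1 := by
  have := Finset.le_sup (f := fun t => #(D.bag t)) (mem_univ t)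
  unfold width
  omega

/-- The nodes whose bags contain a vertex outside `D.bag t` are connected in the tree without any
given edge at `t`. -/
lemma reachable_deleteEdges_of_mem_bag {t : I} {e : Sym2 I} (he : t ∈ e) {v : V}
    (hv : v ∉ D.bag t) {s s' : I} (hs : v ∈ D.bag s) (hs' : v ∈ D.bag s') :
    (D.tree.deleteEdges {e}).Reachable s s' := by
  have h := (D.connected v).preconnected ⟨s, hs⟩ ⟨s', hs'⟩
  let f : D.tree.induce {t | v ∈ D.bag t} →g D.tree.deleteEdges {e} :=
    { toFun := Subtype.val
      map_rel' := by
        rintro ⟨a, ha⟩ ⟨b, hb⟩ hab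
        refine SimpleGraph.deleteEdges_adj.2 ⟨by simpa using hab, ?_⟩
        rintro rfl
        rcases Sym2.mem_iff.1 he with rfl | rfl
        · exact hv ha
        · exact hv hb }
  exact h.map f

/-- The same for the bags that meet a connected component of `G - D.bag t`. -/
lemma reachable_deleteEdges_of_connAvoiding {t : I} {e : Sym2 I} (he : t ∈ e) {v w : V}
    (hvw : ConnAvoiding G (D.bag t) v w) {s s' : I} (hs : v ∈ D.bag s) (hs' : w ∈ D.bag s') :
    (D.tree.deleteEdges {e}).Reachable s s' := by
  obtain ⟨hv, hw, ⟨p⟩⟩ := hvw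
  suffices H : ∀ (x y : ↥((D.bag t : Set V)ᶜ)) (_ : (G.induce (D.bag t : Set V)ᶜ).Walk x y)
      (s s' : I), x.1 ∈ D.bag s → y.1 ∈ D.bag s' → (D.tree.deleteEdges {e}).Reachable s s' from
    H _ _ p s s' hs hs'
  intro x y p
  induction p with
  | @nil x =>
    intro s s' h h'
    exact D.reachable_deleteEdges_of_mem_bag he (fun h => x.2 (mem_coe.2 h)) h h'
  | @cons x z y hxz p ih =>
    intro s s' h h'
    obtain ⟨r, hxr, hzr⟩ := D.exists_edge_bag x.1 z.1 (by simpa using hxz)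
    exact (D.reachable_deleteEdges_of_mem_bag he (fun h => x.2 (mem_coe.2 h)) h hxr).trans
      (ih r s' hzr h')

/-- A tree decomposition has a bag `X` such that every component of `G - X` contains at most half
of `A`. -/
theorem exists_balanced_bag [Fintype I] (A : Finset V)
    [∀ S : Set V, DecidableRel (ConnAvoiding G S)] :
    ∃ t, ∀ v, 2 * #{a ∈ A | ConnAvoiding G (D.bag t) v a} ≤ #A := by
  classical
  by_contra! hcon
  choose c hc using hcon
  have hc0 : ∀ t, c t ∉ D.bag t := fun t h => by
    have : #{a ∈ A | ConnAvoiding G (D.bag t) (c t) a} = 0 := by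
      rw [card_eq_zero, filter_eq_empty_iff]
      rintro a - ⟨h', -⟩
      exact h' h
    have := hc t
    omega
  have hmeet : ∀ t t', ∃ a, ConnAvoiding G (D.bag t) (c t) a ∧
      ConnAvoiding G (D.bag t') (c t') a := by
    intro t t'
    by_contra! h
    have hd : Disjoint {a ∈ A | ConnAvoiding G (D.bag t) (c t) a}
        {a ∈ A | ConnAvoiding G (D.bag t') (c t') a} :=
      disjoint_filter.2 fun a _ h1 h2 => h a h1 h2
    have h1 := card_le_card (union_subset (filter_subset (ConnAvoiding G (D.bag t) (c t)) A)
      (filter_subset (ConnAvoiding G (D.bag t') (c t')) A))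
    rw [card_union_of_disjoint hd] at h1
    have := hc t
    have := hc t'
    omega
  have hstep : ∀ t, ∃ t', D.tree.Adj t t' ∧
      ∃ s, c t ∈ D.bag s ∧ (D.tree.deleteEdges {s(t, t')}).Reachable t' s := by
    intro t
    obtain ⟨s, hs⟩ := D.exists_mem_bag (c t)
    obtain ⟨p, hp⟩ := (D.isTree.connected.preconnected t s).exists_isPath
    cases p with
    | nil => exact absurd hs (hc0 t)
    | @cons _ t' _ h q =>
      refine ⟨t', h, s, hs, SimpleGraph.reachable_deleteEdges_iff_exists_walk.2 ⟨q, fun hq => ?_⟩⟩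
      exact ((SimpleGraph.Walk.cons_isPath_iff h q).1 hp).2 (q.fst_mem_support_of_mem_edges hq)
  choose p hadj hp using hstep
  have hcard := D.isTree.card_edgeFinset
  obtain ⟨t, -, t', -, hne, heq⟩ := exists_ne_map_eq_of_card_lt_of_maps_to
    (s := univ) (t := D.tree.edgeFinset) (f := fun t => s(t, p t))
    (by rw [card_univ]; omega) (fun t _ => by simpa using hadj t)
  have hpt : p t = t' ∧ p t' = t := by
    rcases Sym2.eq_iff.1 heq with ⟨h, -⟩ | ⟨h, h'⟩
    · exact absurd h hne
    · exact ⟨h', h.symm⟩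
  obtain ⟨a, ha, ha'⟩ := hmeet t t'
  obtain ⟨r, hr⟩ := D.exists_mem_bag a
  obtain ⟨s, hs, hts⟩ := hp t
  obtain ⟨s', hs', hts'⟩ := hp t'
  rw [hpt.1] at hts
  rw [hpt.2, Sym2.eq_swap] at hts'
  have h1 := D.reachable_deleteEdges_of_connAvoiding (e := s(t, t')) (by simp) ha hs hr
  have h2 := D.reachable_deleteEdges_of_connAvoiding (e := s(t, t')) (by simp) ha' hs' hr
  have hbr : D.tree.IsBridge s(t, t') :=
    SimpleGraph.isAcyclic_iff_forall_isBridge.1 D.isTree.isAcyclic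
      (by simpa [hpt.1] using hadj t)
  exact SimpleGraph.isBridge_iff.1 hbr (hts'.trans (h2.trans (h1.symm.trans hts.symm)))

/-- The tree decomposition with a single bag. -/
def single [Fintype V] (G : SimpleGraph V) : TreeDecomposition G Unit where
  tree := ⊥
  isTree := .of_subsingleton
  bag _ := univ
  exists_mem_bag _ := ⟨(), mem_univ _⟩
  exists_edge_bag _ _ _ := ⟨(), mem_univ _, mem_univ _⟩
  connected v := by
    have : Nonempty {t : Unit | v ∈ (univ : Finset V)} := ⟨⟨(), mem_univ _⟩⟩
    exact SimpleGraph.Connected.mk fun x y => by rw [Subsingleton.elim x y]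

end TreeDecomposition

lemma exists_width_eq_treewidth {V : Type*} [Finite V] (G : SimpleGraph V) :
    ∃ (I : Type) (_ : Fintype I) (D : TreeDecomposition G I), D.width = treewidth G := by
  have := Fintype.ofFinite V
  exact Nat.sInf_mem (s := {k | ∃ (I : Type) (_ : Fintype I) (D : TreeDecomposition G I),
    D.width = k}) ⟨_, Unit, inferInstance, TreeDecomposition.single G, rfl⟩

open scoped Pointwise

section Slices

variable {α : Type*} [DecidableEq α]

lemma exists_perm_smul_eq {x y : Finset α} (h : #x = #y) : ∃ σ : Equiv.Perm α, σ • x = y := by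
  have := Set.powersetCard.isPretransitive (α := α) (n := #y)
  obtain ⟨σ, hσ⟩ := MulAction.exists_smul_eq (Equiv.Perm α)
    (⟨x, h⟩ : Set.powersetCard α #y) ⟨y, rfl⟩
  exact ⟨σ, congrArg Subtype.val hσ⟩

variable [Fintype α]

/-- A uniformly random image of a set lies in `S` with probability the density of `S`. -/
lemma card_perm_smul_mem (S : Finset (Finset α)) (x : Finset α) :
    (Fintype.card α).choose #x * #{σ : Equiv.Perm α | σ • x ∈ S} =
      Fintype.card (Equiv.Perm α) * #{s ∈ S | #s = #x} := by
  have h1 : ∀ y ∈ powersetCard #x (univ : Finset α),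
      #{σ : Equiv.Perm α | σ • y ∈ S} = #{σ : Equiv.Perm α | σ • x ∈ S} := by
    intro y hy
    obtain ⟨τ, rfl⟩ := exists_perm_smul_eq (mem_powersetCard.1 hy).2.symm
    refine card_equiv (Equiv.mulRight τ) fun σ => ?_
    simp [mul_smul]
  have h2 : ∀ σ ∈ (univ : Finset (Equiv.Perm α)),
      #{y ∈ powersetCard #x (univ : Finset α) | σ • y ∈ S} = #{s ∈ S | #s = #x} := by
    intro σ _
    refine card_equiv (MulAction.toPerm σ) fun y => ?_
    simp [mem_powersetCard, and_comm]
  have h := sum_card_bipartiteAbove_eq_sum_card_bipartiteBelow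
    (s := powersetCard #x (univ : Finset α)) (t := (univ : Finset (Equiv.Perm α)))
    (fun y σ => σ • y ∈ S)
  simp only [bipartiteAbove, bipartiteBelow] at h
  rw [sum_congr rfl h1, sum_congr rfl h2] at h
  simpa [card_powersetCard] using h

variable {S : Finset (Finset α)} {P : Finset α → Finset α → Prop} [DecidableRel P] {d : ℕ}

/-- Follow a path of at most `d` swaps from `x` to `y`, and move it by a random permutation. -/
lemma card_perm_not_le (hrefl : ∀ x, #x = d → x ∉ S → P x x)
    (hstep : ∀ x z y b, #x = d → P x z → #z = d → #y = d → #b = d + 1 → z ⊆ b → y ⊆ b →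
      b ∉ S → y ∉ S → P x y) {p q : ℕ} (hp : ∀ x, #x = d → #{σ : Equiv.Perm α | σ • x ∈ S} = p)
    (hq : ∀ b, #b = d + 1 → #{σ : Equiv.Perm α | σ • b ∈ S} = q) (j : ℕ) :
    ∀ x y : Finset α, #x = d → #y = d → #(y \ x) = j →
      #{σ : Equiv.Perm α | ¬ P (σ • x) (σ • y)} ≤ (j + 1) * p + j * q := by
  induction j with
  | zero =>
    intro x y hx hy hj
    have hyx : y = x := eq_of_subset_of_card_le (sdiff_eq_empty_iff_subset.1 (card_eq_zero.1 hj))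
      (by omega)
    subst hyx
    simp only [zero_add, one_mul, zero_mul, add_zero]
    rw [← hp y hy]
    refine card_le_card fun σ => ?_
    simp only [mem_filter, mem_univ, true_and]
    exact fun h => by_contra fun h' => h (hrefl _ (by simpa using hy) h')
  | succ j ih =>
    intro x y hx hy hj
    obtain ⟨u, hu⟩ : (y \ x).Nonempty := card_pos.1 (by omega)
    obtain ⟨v, hv⟩ : (x \ y).Nonempty := card_pos.1 (by
      have h1 := card_sdiff_add_card_inter x y
      have h2 := card_sdiff_add_card_inter y x
      rw [inter_comm] at h2
      omega)
    rw [mem_sdiff] at hu hv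
    have hb : #(insert v y) = d + 1 := by rw [card_insert_of_notMem hv.2, hy]
    have hz : #((insert v y).erase u) = d := by
      rw [card_erase_of_mem (mem_insert_of_mem hu.1), hb]; rfl
    have hzx : #((insert v y).erase u \ x) = j := by
      have : (insert v y).erase u \ x = (y \ x).erase u := by
        ext a
        simp only [mem_sdiff, mem_erase, mem_insert]
        constructor
        · rintro ⟨⟨h1, rfl | h2⟩, h3⟩
          · exact absurd hv.1 h3
          · exact ⟨h1, h2, h3⟩
        · rintro ⟨h1, h2, h3⟩
          exact ⟨⟨h1, Or.inr h2⟩, h3⟩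
      rw [this, card_erase_of_mem (mem_sdiff.2 hu), hj]; rfl
    have hsub : ({σ : Equiv.Perm α | ¬ P (σ • x) (σ • y)} : Finset _) ⊆
        ({σ : Equiv.Perm α | ¬ P (σ • x) (σ • (insert v y).erase u)} : Finset _) ∪
        (({σ : Equiv.Perm α | σ • insert v y ∈ S} : Finset _) ∪
        ({σ : Equiv.Perm α | σ • y ∈ S} : Finset _)) := by
      intro σ
      simp only [mem_filter, mem_univ, true_and, mem_union]
      contrapose!
      rintro ⟨h1, h2, h3⟩
      exact hstep _ _ _ (σ • insert v y) (by simpa using hx) h1 (by rw [card_smul_finset, hz])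
        (by simpa using hy) (by rw [card_smul_finset, hb])
        (smul_finset_subset_smul_finset (erase_subset _ _))
        (smul_finset_subset_smul_finset (subset_insert _ _)) h2 h3
    have h1 := (card_le_card hsub).trans ((card_union_le _ _).trans
      (Nat.add_le_add_left (card_union_le _ _) _))
    have h2 := ih x _ hx hz hzx
    rw [hp y hy, hq _ hb] at h1
    linarith

/-- A relation on `d`-sets containing connectivity, in the inclusion graph of levels `d` and
`d + 1`, outside `S` misses at most a fraction `(d + 1) |S| / binom n d` of all pairs. -/
theorem card_not_le (hd : 2 * d + 1 ≤ Fintype.card α) (hrefl : ∀ x, #x = d → x ∉ S → P x x)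
    (hstep : ∀ x z y b, #x = d → P x z → #z = d → #y = d → #b = d + 1 → z ⊆ b → y ⊆ b →
      b ∉ S → y ∉ S → P x y) :
    ∑ x ∈ powersetCard d (univ : Finset α), #{y ∈ powersetCard d (univ : Finset α) | ¬ P x y} ≤
      (Fintype.card α).choose d * ((d + 1) * #S) := by
  set N := (Fintype.card α).choose d with hN
  set M := Fintype.card (Equiv.Perm α) with hM
  set A := powersetCard d (univ : Finset α) with hA
  have hAN : #A = N := by simp [hA, hN, card_powersetCard]
  have hMpos : 0 < M := Fintype.card_pos
  obtain ⟨x₀, -, hx₀⟩ := exists_subset_card_eq (s := (univ : Finset α)) (n := d)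
    (by rw [card_univ]; omega)
  obtain ⟨b₀, -, hb₀⟩ := exists_subset_card_eq (s := (univ : Finset α)) (n := d + 1)
    (by rw [card_univ]; omega)
  have hNpos : 0 < N := Nat.choose_pos (by omega)
  have hNB : N ≤ (Fintype.card α).choose (d + 1) := by
    refine Nat.le_of_mul_le_mul_right ?_ d.succ_pos
    rw [Nat.choose_succ_right_eq]
    exact Nat.mul_le_mul_left _ (by omega)
  set p := #{σ : Equiv.Perm α | σ • x₀ ∈ S} with hpdef
  set q := #{σ : Equiv.Perm α | σ • b₀ ∈ S} with hqdef
  have hp0 := card_perm_smul_mem S x₀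
  have hq0 := card_perm_smul_mem S b₀
  rw [hx₀, ← hN, ← hpdef] at hp0
  rw [hb₀, ← hqdef] at hq0
  have hp : ∀ x, #x = d → #{σ : Equiv.Perm α | σ • x ∈ S} = p := by
    intro x hx
    have h := card_perm_smul_mem S x
    rw [hx, ← hp0] at h
    exact Nat.eq_of_mul_eq_mul_left hNpos h
  have hq : ∀ b, #b = d + 1 → #{σ : Equiv.Perm α | σ • b ∈ S} = q := by
    intro x hx
    have h := card_perm_smul_mem S x
    rw [hx, ← hq0] at h
    exact Nat.eq_of_mul_eq_mul_left (hNpos.trans_le hNB) h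
  have hSS : #{s ∈ S | #s = d} + #{s ∈ S | #s = d + 1} ≤ #S := by
    rw [← card_union_of_disjoint (disjoint_filter.2 fun s _ h h' => by omega)]
    exact card_le_card (union_subset (filter_subset _ _) (filter_subset _ _))
  have hpq : N * (p + q) ≤ M * #S := by
    calc N * (p + q) ≤ N * p + (Fintype.card α).choose (d + 1) * q := by
          rw [mul_add]; gcongr
      _ = M * (#{s ∈ S | #s = d} + #{s ∈ S | #s = d + 1}) := by rw [hp0, hq0, mul_add]
      _ ≤ M * #S := by gcongr
  have hF : ∀ x ∈ A, ∀ y ∈ A, #{σ : Equiv.Perm α | ¬ P (σ • x) (σ • y)} ≤ (d + 1) * (p + q) := by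
    intro x hx y hy
    have hx' := (mem_powersetCard.1 hx).2
    have hy' := (mem_powersetCard.1 hy).2
    have h := card_perm_not_le hrefl hstep hp hq _ x y hx' hy' rfl
    have hj : #(y \ x) ≤ d := (card_le_card sdiff_subset).trans hy'.le
    calc _ ≤ _ := h
      _ ≤ (d + 1) * p + (d + 1) * q := by gcongr; omega
      _ = _ := by ring
  have hinv : ∀ σ : Equiv.Perm α,
      ∑ x ∈ A, #{y ∈ A | ¬ P (σ • x) (σ • y)} = ∑ x ∈ A, #{y ∈ A | ¬ P x y} := by
    intro σ
    refine sum_equiv (MulAction.toPerm σ) (fun x => ?_) fun x _ => ?_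
    · simp [hA, mem_powersetCard]
    · refine card_equiv (MulAction.toPerm σ) fun y => ?_
      simp [hA, mem_powersetCard]
  have hswap : M * ∑ x ∈ A, #{y ∈ A | ¬ P x y} =
      ∑ x ∈ A, ∑ y ∈ A, #{σ : Equiv.Perm α | ¬ P (σ • x) (σ • y)} := by
    calc M * ∑ x ∈ A, #{y ∈ A | ¬ P x y}
        = ∑ σ : Equiv.Perm α, ∑ x ∈ A, #{y ∈ A | ¬ P (σ • x) (σ • y)} := by
          rw [sum_congr rfl fun σ _ => hinv σ]; simp [hM]
      _ = ∑ x ∈ A, ∑ σ : Equiv.Perm α, #{y ∈ A | ¬ P (σ • x) (σ • y)} := sum_comm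
      _ = _ := sum_congr rfl fun x _ => by
          simp only [card_filter]
          exact sum_comm
  have hle : ∑ x ∈ A, ∑ y ∈ A, #{σ : Equiv.Perm α | ¬ P (σ • x) (σ • y)} ≤
      N * (N * ((d + 1) * (p + q))) := by
    calc _ ≤ ∑ x ∈ A, ∑ y ∈ A, (d + 1) * (p + q) :=
          sum_le_sum fun x hx => sum_le_sum fun y hy => hF x hx y hy
      _ = _ := by simp [hAN]
  refine Nat.le_of_mul_le_mul_left ?_ hMpos
  calc M * ∑ x ∈ A, #{y ∈ A | ¬ P x y} ≤ N * (N * ((d + 1) * (p + q))) := hswap.trans_le hle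
    _ = N * (d + 1) * (N * (p + q)) := by ring
    _ ≤ N * (d + 1) * (M * #S) := by gcongr
    _ = M * (N * ((d + 1) * #S)) := by ring

end Slices


lemma mem_hasse_vertices {n d : ℕ} {x : Finset (Fin n)} (h : #x = d ∨ #x = d + 1) :
    x ∈ (fullSimplex n).withCard d ∪ (fullSimplex n).withCard (d + 1) :=
  h.imp (fun h => ⟨Set.mem_univ _, h⟩) fun h => ⟨Set.mem_univ _, h⟩

lemma one_le_treewidth_of_adj {V : Type*} [Finite V] {G : SimpleGraph V} {u v : V}
    (h : G.Adj u v) : 1 ≤ treewidth G := by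
  obtain ⟨I, _, D, hD⟩ := exists_width_eq_treewidth G
  obtain ⟨t, hu, hv⟩ := D.exists_edge_bag u v h
  have h1 : 1 < #(D.bag t) := one_lt_card.2 ⟨u, hu, v, hv, h.ne⟩
  have h2 := D.card_bag_le_width_add_one t
  omega

theorem choose_le_mul_treewidth_add_one {n d : ℕ} (hn : 2 * d + 1 ≤ n) :
    n.choose d ≤ 2 * (d + 1) * (treewidth (hasse (fullSimplex n) d) + 1) := by
  classical
  set G := hasse (fullSimplex n) d
  obtain ⟨I, _, D, hD⟩ := exists_width_eq_treewidth G
  have := Fintype.ofFinite ↥((fullSimplex n).withCard d ∪ (fullSimplex n).withCard (d + 1))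
  set A := powersetCard d (univ : Finset (Fin n)) with hA
  have hAN : #A = n.choose d := by simp [hA, card_powersetCard]
  set A' : Finset ↥((fullSimplex n).withCard d ∪ (fullSimplex n).withCard (d + 1)) :=
    {x | #x.1 = d} with hA'
  obtain ⟨t, ht⟩ := D.exists_balanced_bag A'
  set S : Finset (Finset (Fin n)) := (D.bag t).map (Function.Embedding.subtype _) with hS
  have hmem : ∀ (x : Finset (Fin n)) (hx), x ∉ S → (⟨x, hx⟩ : Subtype _) ∉ (D.bag t : Set _) :=
    fun x hx h h' => h (mem_map.2 ⟨⟨x, hx⟩, mem_coe.1 h', rfl⟩)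
  let P : Finset (Fin n) → Finset (Fin n) → Prop := fun x y =>
    ∃ hx hy, ConnAvoiding G (D.bag t) ⟨x, hx⟩ ⟨y, hy⟩
  have hle := card_not_le (S := S) (P := P) (d := d) (by simpa using hn)
    (fun x hx hxS => ⟨mem_hasse_vertices (.inl hx), mem_hasse_vertices (.inl hx),
      .refl (hmem _ _ hxS)⟩)
    (by
      rintro x z y b - ⟨hx, hz, h⟩ hzd hyd hbd hzb hyb hbS hyS
      have hzS : (⟨z, hz⟩ : Subtype _) ∉ (D.bag t : Set _) := h.2.1
      have hb := mem_hasse_vertices (.inr hbd)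
      have hy := mem_hasse_vertices (.inl hyd)
      refine ⟨hx, hy, (h.trans (v := ⟨z, hz⟩) (.of_adj hzS (hmem b hb hbS) ?_)).trans
        (.of_adj (hmem b hb hbS) (hmem y hy hyS) ?_)⟩
      · exact .inl ⟨hzd, hbd, hzb⟩
      · exact .inr ⟨hyd, hbd, hyb⟩)
  rw [Fintype.card_fin, ← hA] at hle
  have hA'N : #A' ≤ n.choose d := by
    rw [← hAN]
    refine card_le_card_of_injOn Subtype.val (fun x hx => ?_) Subtype.val_injective.injOn
    simpa [hA, hA', mem_powersetCard] using hx
  have hhalf : ∀ x ∈ A, n.choose d ≤ 2 * #{y ∈ A | ¬ P x y} := by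
    intro x hx
    have hx' := mem_hasse_vertices (.inl (mem_powersetCard.1 hx).2)
    have h1 : #{y ∈ A | P x y} ≤ #{a ∈ A' | ConnAvoiding G (D.bag t) ⟨x, hx'⟩ a} := by
      refine card_le_card_of_surjOn Subtype.val fun y hy => ?_
      obtain ⟨hyA, _, hy', h⟩ := mem_filter.1 (mem_coe.1 hy)
      exact ⟨⟨y, hy'⟩, by simpa [hA', h] using (mem_powersetCard.1 hyA).2, rfl⟩
    have h2 := ht ⟨x, hx'⟩
    have h3 : #{y ∈ A | P x y} + #{y ∈ A | ¬ P x y} = #A := card_filter_add_card_filter_not _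
    omega
  have hsum : n.choose d * n.choose d ≤ n.choose d * (2 * ((d + 1) * #S)) := by
    calc n.choose d * n.choose d = ∑ x ∈ A, n.choose d := by simp [hAN]
      _ ≤ ∑ x ∈ A, 2 * #{y ∈ A | ¬ P x y} := sum_le_sum hhalf
      _ = 2 * ∑ x ∈ A, #{y ∈ A | ¬ P x y} := by rw [mul_sum]
      _ ≤ 2 * (n.choose d * ((d + 1) * #S)) := by gcongr
      _ = _ := by ring
  have hSle : #S ≤ treewidth G + 1 := by
    rw [hS, card_map, ← hD]
    exact D.card_bag_le_width_add_one t
  calc n.choose d ≤ 2 * ((d + 1) * #S) :=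
        Nat.le_of_mul_le_mul_left hsum (Nat.choose_pos (by omega))
    _ ≤ 2 * ((d + 1) * (treewidth G + 1)) := by gcongr
    _ = _ := by ring

lemma one_le_treewidth_hasse {n d : ℕ} (hn : 2 * d + 1 ≤ n) :
    1 ≤ treewidth (hasse (fullSimplex n) d) := by
  obtain ⟨b, -, hb⟩ := exists_subset_card_eq (s := (univ : Finset (Fin n))) (n := d + 1)
    (by rw [card_fin]; omega)
  obtain ⟨x, hxb, hx⟩ := exists_subset_card_eq (s := b) (n := d) (by omega)
  exact one_le_treewidth_of_adj (u := ⟨x, mem_hasse_vertices (.inl hx)⟩)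
    (v := ⟨b, mem_hasse_vertices (.inr hb)⟩) (.inl ⟨hx, hb, hxb⟩)

end HasseTreewidth

theorem mainTheorem5 :
    ∃ c : ℝ, 0 < c ∧ ∀ d n : ℕ, 2 * d + 1 ≤ n →
      c * ((n.choose d : ℝ) * (1 / ((d : ℝ) + 1))) ≤
        (HasseTreewidth.treewidth (HasseTreewidth.hasse (HasseTreewidth.fullSimplex n) d) : ℝ) := by
  refine ⟨1 / 4, by norm_num, fun d n hn => ?_⟩
  have h1 := HasseTreewidth.choose_le_mul_treewidth_add_one hn
  have h2 := HasseTreewidth.one_le_treewidth_hasse hn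
  set w := HasseTreewidth.treewidth (HasseTreewidth.hasse (HasseTreewidth.fullSimplex n) d)
  have h3 : n.choose d ≤ 4 * (d + 1) * w := by nlinarith
  have h4 : (n.choose d : ℝ) ≤ 4 * (d + 1) * w := by exact_mod_cast h3
  have hd : (0 : ℝ) < d + 1 := by positivity
  rw [mul_one_div, ← mul_div_assoc, div_le_iff₀ hd]
  linarith
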